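/- Let $n\ge 1$ and let $p:\mathbb R^n\to[1,\infty)$ be a bounded variable exponent such that $1/p$ is log-Hölder continuous on bounded sets, i.e. for every ball $B\subset\mathbb R^n$ there is $L>0$ with $$\Big|\frac1{p(x)}-\frac1{p(y)}\Big|\le \frac{L}{\log(e+1/|x-y|)}\qquad\text{for all distinct } x,y\in B .$$ Write $p^-:=\operatorname{ess\,inf}_{\mathbb R^n}p$ and assume $p^->1$ and $p^->n$. Let $\mathcal A:\mathbb R^n\times\mathbb R\times\mathbb R^n\to\mathbb R^n$ be a Carathéodory function ($x\mapsto\mathcal A(x,t,\xi)$ is measurable for all $(t,\xi)$, and $(t,\xi)\mapsto\mathcal A(x,t,\xi)$ is continuous for all $x$) of $p(\cdot)$-growth: there are measurable functions $a,b:\mathbb R^n\to\mathbb R$ and constants $a_->0$, $b^+<\infty$ with $a_-\le a\le b\le b^+$ on $\mathbb R^n$ such that, for all $(x,t,\xi)\in\mathbb R^n\times\mathbb R\times\mathbb R^n$, $$\langle\mathcal A(x,t,\xi),\xi\rangle\ge a(x)|\xi|^{p(x)},\qquad |\mathcal A(x,t,\xi)|\le b(x)|\xi|^{p(x)-1}.$$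 Let $f:\mathbb R\to[0,\infty)$ be continuous and strictly increasing with $f(0)\neq0$. A function $u\in W^{1,p(\cdot)}_{loc}(\mathbb R^n)$ (that is, $u$ and its distributional gradient $\nabla u$ belong to the variable exponent Lebesgue space $L^{p(\cdot)}(K)$ for every compact $K\subset\mathbb R^n$, where $w\in L^{p(\cdot)}(K)$ means that $w$ is measurable and $\int_K|w(x)/\mu|^{p(x)}\,dx<\infty$ for some $\mu>0$) is called a supersolution of $$\operatorname{div}\mathcal A(x,u,\nabla u)\ge f(u)\quad\text{in }\mathbb R^n$$ if $$-\int_{\mathbb R^n}\langle\mathcal A(x,u,\nabla u),\nabla\phi\rangle\,dx\ \ge\ \int_{\mathbb R^n}f(u)\,\phi\,dx\qquad\text{for all nonnegative }\phi\in C_0^\infty(\mathbb R^n).$$ Then there exists no (essentially) bounded supersolution. -/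

import Mathlib

open MeasureTheory Metric

/-- The Euclidean space of dimension `n`. -/
abbrev Eucl (n : ℕ) : Type := EuclideanSpace ℝ (Fin n)

/-- Log-Hölder continuity of `α` on the set `S`. -/
def IsLogHolderOn {n : ℕ} (α : Eucl n → ℝ) (S : Set (Eucl n)) : Prop :=
  ∃ L : ℝ, 0 < L ∧ ∀ x ∈ S, ∀ y ∈ S,
    |α x - α y| ≤ L / Real.log (Real.exp 1 + 1 / ‖x - y‖)

/-- Bounded log-Hölder continuous variable exponents on the whole space, with `1 < p⁻` and
`p⁺ < ∞`. Since only bounded exponents occur, they are taken real-valued. Log-Hölder continuity of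
`1 / p` is asked for on bounded sets only, with a constant that may depend on the set. -/
structure IsVariableExponent {n : ℕ} (p : Eucl n → ℝ) : Prop where
  measurable : AEMeasurable p volume
  one_le : ∀ x, 1 ≤ p x
  one_lt_essInf : 1 < essInf p volume
  bddAbove : ∃ C : ℝ, ∀ᵐ x ∂(volume : Measure (Eucl n)), p x ≤ C
  logHolder : ∀ r : ℝ, IsLogHolderOn (fun x => 1 / p x) (ball 0 r)

/-- The semimodular `∫_S |w|^{p(x)} dx`, for scalar or vector valued `w`. -/
noncomputable def modular {n : ℕ} {F : Type*} [NormedAddCommGroup F] (p : Eucl n → ℝ)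
    (S : Set (Eucl n)) (w : Eucl n → F) : ENNReal :=
  ∫⁻ x in S, ENNReal.ofReal (‖w x‖ ^ p x)

/-- `w` belongs to the variable exponent Lebesgue space `L^{p(·)}(S)`: it is measurable and
the modular of `w / μ` is finite for some `μ > 0`. -/
def MemVarLp {n : ℕ} {F : Type*} [NormedAddCommGroup F] [NormedSpace ℝ F] (p : Eucl n → ℝ)
    (S : Set (Eucl n)) (w : Eucl n → F) : Prop :=
  AEStronglyMeasurable w (volume.restrict S) ∧
    ∃ μ : ℝ, 0 < μ ∧ modular p S (fun x => μ⁻¹ • w x) < ⊤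

/-- Test functions: the elements of `C_0^∞(ℝⁿ)`. -/
def IsTestFunction {n : ℕ} (φ : Eucl n → ℝ) : Prop :=
  ContDiff ℝ ((⊤ : ℕ∞) : WithTop ℕ∞) φ ∧ HasCompactSupport φ

/-- `v` is the distributional gradient of `u` on the whole space. -/
def HasWeakGradient {n : ℕ} (u : Eucl n → ℝ) (v : Eucl n → Eucl n) : Prop :=
  LocallyIntegrable u volume ∧ LocallyIntegrable v volume ∧
    ∀ φ : Eucl n → ℝ, IsTestFunction φ →
      ∫ x, u x • gradient φ x = - ∫ x, φ x • v x

/-- `u` belongs to `W^{1,p(·)}_loc(ℝⁿ)` and `v` is (a representative of) its distributional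
gradient. -/
structure MemVarSobolevLoc {n : ℕ} (p : Eucl n → ℝ) (u : Eucl n → ℝ)
    (v : Eucl n → Eucl n) : Prop where
  weakGradient : HasWeakGradient u v
  memLp : ∀ K : Set (Eucl n), IsCompact K → MemVarLp p K u
  memLp_gradient : ∀ K : Set (Eucl n), IsCompact K → MemVarLp p K v

/-- Carathéodory functions: (Lebesgue) measurable in the first variable, and jointly continuous
in the other two. -/
structure IsCaratheodory {n : ℕ} (A : Eucl n → ℝ → Eucl n → Eucl n) : Prop where
  measurable : ∀ (t : ℝ) (ξ : Eucl n), AEMeasurable (fun x => A x t ξ) volume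
  continuous : ∀ x : Eucl n, Continuous (fun q : ℝ × Eucl n => A x q.1 q.2)

/-- Carathéodory functions `A` of `p(·)`-growth. -/
structure HasVarGrowth {n : ℕ} (p : Eucl n → ℝ) (A : Eucl n → ℝ → Eucl n → Eucl n) :
    Prop where
  caratheodory : IsCaratheodory A
  bounds : ∃ (a b : Eucl n → ℝ) (aMinus bPlus : ℝ),
    AEMeasurable a volume ∧ AEMeasurable b volume ∧ 0 < aMinus ∧
    (∀ x, aMinus ≤ a x) ∧ (∀ x, a x ≤ b x) ∧ (∀ x, b x ≤ bPlus) ∧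
    (∀ x t ξ, a x * ‖ξ‖ ^ p x ≤ inner ℝ (A x t ξ) ξ) ∧
    (∀ x t ξ, ‖A x t ξ‖ ≤ b x * ‖ξ‖ ^ (p x - 1))

/-- `u ∈ W^{1,p(·)}_loc(ℝⁿ)` is a supersolution of `div A(x, u, ∇u) ≥ f(u)` in `ℝⁿ`, i.e.
`-∫ ⟨A(x, u, ∇u), ∇φ⟩ ≥ ∫ f(u) φ` for all nonnegative test functions `φ`. The left-hand integrand
is integrable as soon as `A` is of `p(·)`-growth. The right-hand integral, of a nonnegative
function when `f ≥ 0`, has to be finite; this holds automatically if `u` is bounded and `f`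
continuous. -/
def IsSupersolution {n : ℕ} (p : Eucl n → ℝ) (A : Eucl n → ℝ → Eucl n → Eucl n) (f : ℝ → ℝ)
    (u : Eucl n → ℝ) : Prop :=
  ∃ v : Eucl n → Eucl n, MemVarSobolevLoc p u v ∧
    ∀ φ : Eucl n → ℝ, IsTestFunction φ → (∀ x, 0 ≤ φ x) →
      Integrable (fun x => f (u x) * φ x) volume ∧
      ∫ x, f (u x) * φ x ≤ - ∫ x, inner ℝ (A x (u x) (v x)) (gradient φ x)

/-! Suppose `|u| ≤ M` a.e. Then `f (u x) ≥ f (-M) =: c`, and `c > 0` because `f` is nonnegative and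
strictly increasing. Write `v` for the weak gradient and `a x = A x (u x) (v x)`. Test formally with
`η ^ (k + 1) * (u + M + 1)`, where `0 ≤ η ≤ 1` is a cut-off. Coercivity and growth give `c ∫ η^(k+1)
+ α ∫ η^(k+1) |v|^p ≤ N ∫ η^k |v|^(p-1) |∇η|`, with `N = (2M+1)(k+1)B`. If `p ≤ k + 1` and `N |∇η| ≤
α`, a pointwise Young inequality (`mul_rpow_sub_one_mul_pow_le`) bounds the right side by `α ∫
η^(k+1) |v|^p + N ∫ |∇η|`. The energy cancels, which leaves `c ∫ η^(k+1) ≤ N ∫ |∇η|`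
(`integral_cutoff_pow_le`). For `η (x / R)` the left side scales like `R^n` and the right side like
`R^(n-1)`, a contradiction as `R → ∞`.

The formal test function is not smooth, so `u` is first mollified
(`integral_add_integral_inner_le`). The delicate limit is that of `∫ ψ ⟨a, ∇u_j⟩`. Log-Hölder
continuity gives, locally and with `C` independent of `j`, that `|∇u_j|^p ≤ C (1 + (|v|^p)_j)`
(`exists_norm_mollify_rpow_le`). These majorants converge a.e. and their integrals converge as well,
so dominated convergence with a varying majorant applies. -/

open Filter Topology Convolution

/-! ### Measurability of Carathéodory compositions -/

section Caratheodory

variable {α ι β : Type*} [MeasurableSpace α] {μ : Measure α}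

/-- A function of Carathéodory type agrees, outside a null set, with one that is measurable in the
first variable for every value of the parameter. -/
theorem exists_measurable_uncurry_of_continuous_of_aemeasurable
    [TopologicalSpace ι] [TopologicalSpace.MetrizableSpace ι] [SecondCountableTopology ι]
    [MeasurableSpace ι] [BorelSpace ι] [Nonempty ι]
    [TopologicalSpace β] [TopologicalSpace.PseudoMetrizableSpace β] [MeasurableSpace β]
    [BorelSpace β] [Inhabited β]
    {F : ι → α → β} (hc : ∀ x, Continuous fun i => F i x) (hm : ∀ i, AEMeasurable (F i) μ) :
    ∃ G : ι → α → β, Measurable (Function.uncurry G) ∧ ∀ᵐ x ∂μ, ∀ i, F i x = G i x := by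
  classical
  let _ := TopologicalSpace.metrizableSpaceMetric ι
  let d := TopologicalSpace.denseSeq ι
  -- Only countably many parameters are corrected, so the exceptional set is null; continuity in the
  -- parameter carries measurability to all the others.
  let T : Set α := {x | ∀ k, F (d k) x = (hm (d k)).mk _ x}
  have hT : μ Tᶜ = 0 := (ae_all_iff (μ := μ)).2 fun k => (hm (d k)).ae_eq_mk
  let N := toMeasurable μ Tᶜ
  have hN : MeasurableSet N := measurableSet_toMeasurable _ _
  have hN0 : μ N = 0 := by rw [measure_toMeasurable, hT]
  have hNT : ∀ x ∉ N, x ∈ T := fun x hx => by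
    by_contra h
    exact hx (subset_toMeasurable _ _ h)
  -- A constant value on `N` keeps `i ↦ G i x` continuous for every `x`, not merely for almost every
  -- `x`.
  let G : ι → α → β := fun i x => if x ∈ N then default else F i x
  have hGd : ∀ k, Measurable (G (d k)) := fun k => by
    have : G (d k) = fun x => if x ∈ N then default else (hm (d k)).mk _ x := by
      funext x
      by_cases hx : x ∈ N
      · simp [G, hx]
      · simp only [G, hx, if_false]
        exact hNT x hx k
    rw [this]
    exact Measurable.ite hN measurable_const (hm (d k)).measurable_mk
  have hGc : ∀ x, Continuous fun i => G i x := fun x => by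
    by_cases hx : x ∈ N
    · simpa [G, hx] using continuous_const
    · simpa [G, hx] using hc x
  refine ⟨G, measurable_uncurry_of_continuous_of_measurable hGc fun i => ?_, ?_⟩
  · obtain ⟨a, ha, hai⟩ := mem_closure_iff_seq_limit.1 (TopologicalSpace.denseRange_denseSeq ι i)
    refine measurable_of_tendsto_metrizable (f := fun m => G (a m)) (fun m => ?_)
      (tendsto_pi_nhds.2 fun x => ((hGc x).tendsto i).comp hai)
    obtain ⟨k, hk⟩ := ha m
    rw [← hk]
    exact hGd k
  · have : ∀ᵐ x ∂μ, x ∉ N := measure_eq_zero_iff_ae_notMem.1 hN0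
    filter_upwards [this] with x hx i
    simp [G, hx]

theorem aemeasurable_comp_of_continuous_of_aemeasurable
    [TopologicalSpace ι] [TopologicalSpace.MetrizableSpace ι] [SecondCountableTopology ι]
    [MeasurableSpace ι] [BorelSpace ι] [Nonempty ι]
    [TopologicalSpace β] [TopologicalSpace.PseudoMetrizableSpace β] [MeasurableSpace β]
    [BorelSpace β] [Inhabited β]
    {F : ι → α → β} (hc : ∀ x, Continuous fun i => F i x) (hm : ∀ i, AEMeasurable (F i) μ)
    {w : α → ι} (hw : AEMeasurable w μ) : AEMeasurable (fun x => F (w x) x) μ := by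
  obtain ⟨G, hG, hFG⟩ := exists_measurable_uncurry_of_continuous_of_aemeasurable hc hm
  refine (hG.comp_aemeasurable (hw.prodMk aemeasurable_id)).congr ?_
  filter_upwards [hFG] with x hx
  exact (hx _).symm

end Caratheodory

theorem IsCaratheodory.aemeasurable_comp {n : ℕ} {A : Eucl n → ℝ → Eucl n → Eucl n}
    (hA : IsCaratheodory A) {u : Eucl n → ℝ} {v : Eucl n → Eucl n}
    (hu : AEMeasurable u volume) (hv : AEMeasurable v volume) :
    AEMeasurable (fun x => A x (u x) (v x)) volume :=
  aemeasurable_comp_of_continuous_of_aemeasurable (F := fun (q : ℝ × Eucl n) x => A x q.1 q.2)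
    hA.continuous (fun q => hA.measurable q.1 q.2) (hu.prodMk hv)

/-! ### Dominated convergence with a varying majorant -/

/-- A dominated convergence theorem with a varying dominating function. -/
theorem tendsto_integral_of_dominated_of_tendsto {α : Type*} [MeasurableSpace α] {μ : Measure α}
    {h g : ℕ → α → ℝ} {h₀ g₀ : α → ℝ}
    (hh : ∀ j, Integrable (h j) μ) (hg : ∀ j, Integrable (g j) μ) (hg₀ : Integrable g₀ μ)
    (hle : ∀ j, ∀ᵐ x ∂μ, |h j x| ≤ g j x)
    (hlim : ∀ᵐ x ∂μ, Tendsto (fun j => h j x) atTop (𝓝 (h₀ x)))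
    (glim : ∀ᵐ x ∂μ, Tendsto (fun j => g j x) atTop (𝓝 (g₀ x)))
    (hint : Tendsto (fun j => ∫ x, g j x ∂μ) atTop (𝓝 (∫ x, g₀ x ∂μ))) :
    Tendsto (fun j => ∫ x, h j x ∂μ) atTop (𝓝 (∫ x, h₀ x ∂μ)) := by
  have hle' := ae_all_iff.2 hle
  have hg₀nn : ∀ᵐ x ∂μ, |h₀ x| ≤ g₀ x := by
    filter_upwards [hle', hlim, glim] with x h1 h2 h3
    exact le_of_tendsto_of_tendsto' h2.abs h3 h1
  let m : ℕ → α → ℝ := fun j x => min (g j x) (g₀ x)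
  have hm : ∀ j, Integrable (m j) μ := fun j => (hg j).inf hg₀
  -- `c j` is `h j` clamped to `[-m j, m j]`: it has the fixed majorant `g₀`, and the part cut off
  -- is at most `g j - m j`, whose integral tends to `0`.
  let c : ℕ → α → ℝ := fun j x => max (-m j x) (min (h j x) (m j x))
  have hc : ∀ j, Integrable (c j) μ := fun j => (hm j).neg.sup ((hh j).inf (hm j))
  have mlim : Tendsto (fun j => ∫ x, m j x ∂μ) atTop (𝓝 (∫ x, g₀ x ∂μ)) := by
    refine tendsto_integral_of_dominated_convergence g₀ (fun j => (hm j).1) hg₀ (fun j => ?_) ?_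
    · filter_upwards [hle j, hg₀nn] with x h1 h2
      have h3 : 0 ≤ m j x := le_min ((abs_nonneg _).trans h1) ((abs_nonneg _).trans h2)
      rw [Real.norm_of_nonneg h3]
      exact min_le_right _ _
    · filter_upwards [glim] with x hx
      simpa [m] using hx.min (tendsto_const_nhds (x := g₀ x))
  have clim : Tendsto (fun j => ∫ x, c j x ∂μ) atTop (𝓝 (∫ x, h₀ x ∂μ)) := by
    refine tendsto_integral_of_dominated_convergence g₀ (fun j => (hc j).1) hg₀ (fun j => ?_) ?_
    · filter_upwards [hle j, hg₀nn] with x h1 h2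
      have h3 : 0 ≤ m j x := le_min ((abs_nonneg _).trans h1) ((abs_nonneg _).trans h2)
      have h4 : m j x ≤ g₀ x := min_le_right _ _
      rw [Real.norm_eq_abs, abs_le]
      exact ⟨by linarith [le_max_left (-m j x) (min (h j x) (m j x))],
        max_le (by linarith) ((min_le_right _ _).trans h4)⟩
    · filter_upwards [glim, hlim, hg₀nn] with x h1 h2 h3
      have hmx : Tendsto (fun j => m j x) atTop (𝓝 (g₀ x)) := by
        simpa [m] using h1.min (tendsto_const_nhds (x := g₀ x))
      have := hmx.neg.max (h2.min hmx)
      rwa [min_eq_left (abs_le.1 h3).2, max_eq_right (abs_le.1 h3).1] at this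
  have dlim : Tendsto (fun j => ∫ x, (h j x - c j x) ∂μ) atTop (𝓝 0) := by
    have h0 : Tendsto (fun j => ∫ x, (g j x - m j x) ∂μ) atTop (𝓝 0) := by
      have := hint.sub mlim
      rw [sub_self] at this
      refine this.congr fun j => ?_
      rw [integral_sub (hg j) (hm j)]
    refine squeeze_zero_norm (fun j => ?_) h0
    refine norm_integral_le_of_norm_le ((hg j).sub (hm j)) ?_
    filter_upwards [hle j, hg₀nn] with x h1 h2
    have h3 : 0 ≤ m j x := le_min ((abs_nonneg _).trans h1) ((abs_nonneg _).trans h2)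
    have h4 : m j x ≤ g j x := min_le_left _ _
    obtain ⟨h5, h6⟩ := abs_le.1 h1
    have h7 : c j x = max (-m j x) (min (h j x) (m j x)) := rfl
    rw [Real.norm_eq_abs, abs_le, h7]
    rcases le_total (h j x) (m j x) with h8 | h8
    · rw [min_eq_left h8]
      rcases le_total (-m j x) (h j x) with h9 | h9
      · rw [max_eq_right h9]; constructor <;> linarith
      · rw [max_eq_left h9]; constructor <;> linarith
    · rw [min_eq_right h8, max_eq_right (by linarith)]; constructor <;> linarith
  have := dlim.add clim
  rw [zero_add] at this
  refine this.congr fun j => ?_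
  rw [integral_sub (hh j) (hc j)]
  ring

/-! ### Pointwise inequalities and local averaging -/

theorem rpow_sub_one_mul_le_add {s t p : ℝ} (hs : 0 ≤ s) (ht : 0 ≤ t) (hp : 1 ≤ p) :
    s ^ (p - 1) * t ≤ s ^ p + t ^ p := by
  have key : ∀ r : ℝ, 0 ≤ r → r ^ (p - 1) * r = r ^ p := fun r hr => by
    rcases hr.eq_or_lt with rfl | hr
    · rw [mul_zero, Real.zero_rpow (by linarith)]
    · rw [Real.rpow_sub_one hr.ne', div_mul_cancel₀ _ hr.ne']
  rcases le_total s t with h | h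
  · calc s ^ (p - 1) * t ≤ t ^ (p - 1) * t := by gcongr
      _ = t ^ p := key t ht
      _ ≤ _ := le_add_of_nonneg_left (Real.rpow_nonneg hs _)
  · calc s ^ (p - 1) * t ≤ s ^ (p - 1) * s := by gcongr
      _ = s ^ p := key s hs
      _ ≤ _ := le_add_of_nonneg_right (Real.rpow_nonneg ht _)

/-- Young's inequality with a cut-off factor `η`. -/
theorem mul_rpow_sub_one_mul_pow_le {s t η a N p : ℝ} {k : ℕ} (hs : 0 ≤ s) (ht : 0 ≤ t)
    (hη : 0 ≤ η) (hη1 : η ≤ 1) (ha : 0 < a) (hN : 0 ≤ N) (hp : 1 ≤ p) (hk : p ≤ k + 1)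
    (hk1 : 1 ≤ k) (hsmall : N * t ≤ a) :
    N * s ^ (p - 1) * (η ^ k * t) ≤ a * s ^ p * η ^ (k + 1) + N * t := by
  rcases hη.eq_or_lt with rfl | hη0
  · rw [zero_pow (by omega), zero_pow (by omega)]
    simp only [zero_mul, mul_zero, zero_add]
    positivity
  -- Either one factor `N * t` is absorbed into `a * s * η`, or `a * s * η ≤ N * t ≤ a` forces `s *
  -- η ≤ 1`; then `η ^ k ≤ η ^ (p - 1)` makes the remaining factor at most `1`.
  rcases le_total (N * t) (a * (s * η)) with h | h
  · have key : s ^ (p - 1) * s = s ^ p := by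
      rcases hs.eq_or_lt with rfl | hr
      · rw [mul_zero, Real.zero_rpow (by linarith)]
      · rw [Real.rpow_sub_one hr.ne', div_mul_cancel₀ _ hr.ne']
    calc N * s ^ (p - 1) * (η ^ k * t) = s ^ (p - 1) * η ^ k * (N * t) := by ring
      _ ≤ s ^ (p - 1) * η ^ k * (a * (s * η)) := by gcongr
      _ = a * (s ^ (p - 1) * s) * η ^ (k + 1) := by ring
      _ = a * s ^ p * η ^ (k + 1) := by rw [key]
      _ ≤ _ := le_add_of_nonneg_right (by positivity)
  · have h1 : s * η ≤ 1 := by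
      by_contra! h1
      nlinarith
    have h2 : s ^ (p - 1) * η ^ k ≤ 1 := by
      calc s ^ (p - 1) * η ^ k ≤ s ^ (p - 1) * η ^ (p - 1) := by
            rw [← Real.rpow_natCast η k]
            gcongr ?_ * ?_
            exact Real.rpow_le_rpow_of_exponent_ge hη0 hη1 (by linarith)
        _ = (s * η) ^ (p - 1) := (Real.mul_rpow hs hη).symm
        _ ≤ 1 := Real.rpow_le_one (by positivity) h1 (by linarith)
    calc N * s ^ (p - 1) * (η ^ k * t) = (s ^ (p - 1) * η ^ k) * (N * t) := by ring
      _ ≤ 1 * (N * t) := by gcongr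
      _ = N * t := one_mul _
      _ ≤ _ := le_add_of_nonneg_left (by positivity)

/-- Above the level `l` one has `(s / l) ^ (r - 1) ≥ 1`. The level is free, so it can be adapted to
the average being estimated. -/
theorem le_add_rpow_one_sub_mul_rpow {s l r : ℝ} (hs : 0 ≤ s) (hl : 0 < l) (hr : 1 ≤ r) :
    s ≤ l + l ^ (1 - r) * s ^ r := by
  rcases le_total s l with h | h
  · exact h.trans (le_add_of_nonneg_right (by positivity))
  · have hs0 : 0 < s := hl.trans_le h
    calc s = s ^ (1 - r) * s ^ r := by rw [← Real.rpow_add hs0]; simp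
      _ ≤ l ^ (1 - r) * s ^ r := by
        gcongr ?_ * _
        exact Real.rpow_le_rpow_of_nonpos hl h (by linarith)
      _ ≤ _ := le_add_of_nonneg_left hl.le

/-- The logarithm of a quantity of size `ε ^ (-d)` is at most a multiple of `log (e + 1 / ε)`, which
the log-Hölder modulus in the exponent cancels. The bound is therefore uniform in the scale `ε`. -/
theorem rpow_div_log_le_exp {a D L P ε : ℝ} {d : ℕ} (ha : 1 ≤ a) (hD : 1 ≤ D) (hL : 0 ≤ L)
    (hP : 0 ≤ P) (hε : 0 < ε) (haD : a ≤ D * (ε ^ d)⁻¹) :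
    a ^ (P * (L / Real.log (Real.exp 1 + 1 / ε))) ≤ Real.exp (P * L * (Real.log D + d)) := by
  have ha0 : 0 < a := by linarith
  set ℓ := Real.log (Real.exp 1 + 1 / ε) with hℓ
  have h1 : 1 ≤ ℓ := by
    rw [hℓ, Real.le_log_iff_exp_le (by positivity)]
    exact le_add_of_nonneg_right (by positivity)
  have h2 : -Real.log ε ≤ ℓ := by
    rw [← Real.log_inv, ← one_div]
    exact Real.log_le_log (by positivity) (le_add_of_nonneg_left (Real.exp_pos _).le)
  have h3 : Real.log a ≤ Real.log D + d * (-Real.log ε) := by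
    have := Real.log_le_log ha0 haD
    rwa [Real.log_mul (by positivity) (by positivity), Real.log_inv, Real.log_pow,
      ← mul_neg] at this
  have hD0 : 0 ≤ Real.log D := Real.log_nonneg hD
  have h4 : Real.log a ≤ (Real.log D + d) * ℓ := by
    have : (d : ℝ) * (-Real.log ε) ≤ d * ℓ := by gcongr
    nlinarith
  rw [Real.rpow_def_of_pos ha0]
  refine Real.exp_le_exp.2 ?_
  calc Real.log a * (P * (L / ℓ)) ≤ (Real.log D + d) * ℓ * (P * (L / ℓ)) := by gcongr
    _ = P * L * (Real.log D + d) := by field_simp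

/-- The local averaging inequality for variable exponents: it replaces Jensen's inequality, up to a
constant controlled by the oscillation of `1 / p` at the scale of the kernel. -/
theorem convolution_rpow_le {n : ℕ} {p : Eucl n → ℝ} (hp1 : ∀ x, 1 ≤ p x) {P : ℝ}
    (hP : ∀ᵐ x ∂(volume : Measure (Eucl n)), p x ≤ P) {φ : Eucl n → ℝ} (hφ0 : ∀ t, 0 ≤ φ t)
    (hφi : Integrable φ) (hφ1 : ∫ t, φ t = 1) {w G : Eucl n → ℝ} {x : Eucl n} {δ C : ℝ}
    (hpx : p x ≤ P) (hδ : 0 ≤ δ) (hw : ∀ y, 0 ≤ w y) (hG : ∀ y, 0 ≤ G y)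
    (hwφ : Integrable fun t => φ t * w (x - t)) (hGφ : Integrable fun t => φ t * G (x - t))
    (hosc : ∀ t, φ t ≠ 0 → |1 / p x - 1 / p (x - t)| ≤ δ)
    (hwG : ∀ t, φ t ≠ 0 → w (x - t) ^ p (x - t) ≤ G (x - t))
    (hC : (1 + ∫ t, φ t * G (x - t)) ^ (P * δ) ≤ C) :
    (∫ t, φ t * w (x - t)) ^ p x ≤ (1 + C) ^ P * (1 + ∫ t, φ t * G (x - t)) := by
  set I := ∫ t, φ t * G (x - t) with hI
  have hI0 : 0 ≤ I := integral_nonneg fun t => mul_nonneg (hφ0 t) (hG _)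
  have hp0 : 0 < p x := zero_lt_one.trans_le (hp1 x)
  have hC0 : 0 ≤ C := (Real.rpow_nonneg (by linarith) _).trans hC
  -- The splitting level is chosen so that `l ^ p x = 1 + I`; the added `1` gives `l ≥ 1`.
  set l := (1 + I) ^ (1 / p x) with hl
  have hl1 : 1 ≤ l := Real.one_le_rpow (by linarith) (by positivity)
  have hl0 : 0 < l := by linarith
  have hlp : l ^ p x = 1 + I := by
    rw [hl, ← Real.rpow_mul (by linarith), one_div_mul_cancel hp0.ne', Real.rpow_one]
  have hPy : ∀ᵐ t ∂(volume : Measure (Eucl n)), p (x - t) ≤ P :=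
    (quasiMeasurePreserving_sub_left volume x).ae hP
  have hm : ∫ t, φ t * w (x - t) ≤ (1 + C) * l := by
    calc ∫ t, φ t * w (x - t)
        ≤ ∫ t, (φ t * l + C * l ^ (1 - p x) * (φ t * G (x - t))) := by
          refine integral_mono_ae hwφ ((hφi.mul_const _).add (hGφ.const_mul _)) ?_
          filter_upwards [hPy] with t ht
          by_cases h0 : φ t = 0
          · simp [h0]
          have hr : 0 < p (x - t) := zero_lt_one.trans_le (hp1 _)
          have h1 : l ^ (1 - p (x - t)) ≤ C * l ^ (1 - p x) := by
            -- Freezing the exponent at `x` costs `(1 + I) ^ (p y * (1 / p y - 1 / p x))` with `y =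
            -- x - t`, so only the oscillation of `1 / p` enters.
            have h2 : l ^ (p x - p (x - t)) ≤ C := by
              refine le_trans ?_ hC
              rw [hl, ← Real.rpow_mul (by linarith)]
              refine Real.rpow_le_rpow_of_exponent_le (by linarith) ?_
              calc 1 / p x * (p x - p (x - t))
                  = p (x - t) * (1 / p (x - t) - 1 / p x) := by field_simp
                _ ≤ p (x - t) * δ := by
                  gcongr
                  linarith [(abs_le.1 (hosc t h0)).1]
                _ ≤ P * δ := by gcongr
            calc l ^ (1 - p (x - t)) = l ^ (p x - p (x - t)) * l ^ (1 - p x) := by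
                  rw [← Real.rpow_add hl0]; ring_nf
              _ ≤ _ := by gcongr
          calc φ t * w (x - t)
              ≤ φ t * (l + l ^ (1 - p (x - t)) * w (x - t) ^ p (x - t)) := by
                gcongr
                · exact hφ0 t
                · exact le_add_rpow_one_sub_mul_rpow (hw _) hl0 (hp1 _)
            _ ≤ φ t * (l + C * l ^ (1 - p x) * G (x - t)) := by
                gcongr
                · exact hφ0 t
                · exact Real.rpow_nonneg (hw _) _
                · exact hwG t h0
            _ = _ := by ring
      _ = l + C * l ^ (1 - p x) * I := by
          rw [integral_add (hφi.mul_const _) (hGφ.const_mul _), integral_mul_const,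
            integral_const_mul, hφ1, one_mul]
      _ ≤ l + C * l ^ (1 - p x) * l ^ p x := by
          gcongr
          linarith
      _ = (1 + C) * l := by
          rw [mul_assoc, ← Real.rpow_add hl0]
          simp
          ring
  calc (∫ t, φ t * w (x - t)) ^ p x ≤ ((1 + C) * l) ^ p x := by
        gcongr
        exact integral_nonneg fun t => mul_nonneg (hφ0 t) (hw _)
    _ = (1 + C) ^ p x * (1 + I) := by rw [Real.mul_rpow (by linarith) hl0.le, hlp]
    _ ≤ _ := by
      gcongr
      linarith

/-! ### Mollification -/

/-- The standard sequence of bump functions at scales `1 / (j + 1)`. -/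
noncomputable def bumpSeq (n : ℕ) (j : ℕ) : ContDiffBump (0 : Eucl n) where
  rIn := 1 / (j + 1) / 2
  rOut := 1 / (j + 1)
  rIn_pos := by positivity
  rIn_lt_rOut := half_lt_self (by positivity)

theorem bumpSeq_rOut_le_one (n j : ℕ) : (bumpSeq n j).rOut ≤ 1 := by
  have : (0 : ℝ) ≤ j := j.cast_nonneg
  change (1 : ℝ) / (j + 1) ≤ 1
  rw [div_le_one (by positivity)]
  linarith

theorem bumpSeq_rOut_le (n j : ℕ) : (bumpSeq n j).rOut ≤ 2 * (bumpSeq n j).rIn := by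
  change (1 : ℝ) / (j + 1) ≤ 2 * (1 / (j + 1) / 2)
  linarith

theorem tendsto_bumpSeq_rOut (n : ℕ) : Tendsto (fun j => (bumpSeq n j).rOut) atTop (𝓝 0) :=
  tendsto_one_div_add_atTop_nhds_zero_nat

/-- Mollification at scale `1 / (j + 1)`. -/
noncomputable def mollify {n : ℕ} {F : Type*} [NormedAddCommGroup F] [NormedSpace ℝ F]
    (j : ℕ) (w : Eucl n → F) : Eucl n → F :=
  (bumpSeq n j).normed volume ⋆[ContinuousLinearMap.lsmul ℝ ℝ, volume] w

section mollify

variable {n : ℕ} {F : Type*} [NormedAddCommGroup F] [NormedSpace ℝ F]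

theorem mollify_apply (j : ℕ) (w : Eucl n → F) (x : Eucl n) :
    mollify j w x = ∫ t, (bumpSeq n j).normed volume t • w (x - t) := rfl

theorem integrable_normed_smul (j : ℕ) {w : Eucl n → F} (hw : LocallyIntegrable w volume)
    (x : Eucl n) : Integrable fun t => (bumpSeq n j).normed volume t • w (x - t) :=
  ((bumpSeq n j).hasCompactSupport_normed (μ := volume)).convolutionExists_left
    (ContinuousLinearMap.lsmul ℝ ℝ) (bumpSeq n j).continuous_normed hw x

theorem norm_mollify_le (j : ℕ) (w : Eucl n → F) (x : Eucl n) :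
    ‖mollify j w x‖ ≤ ∫ t, (bumpSeq n j).normed volume t * ‖w (x - t)‖ := by
  rw [mollify_apply]
  refine (norm_integral_le_integral_norm _).trans_eq (integral_congr_ae (.of_forall fun t => ?_))
  simp only [norm_smul]
  rw [Real.norm_of_nonneg ((bumpSeq n j).nonneg_normed t)]

theorem mollify_nonneg (j : ℕ) {w : Eucl n → ℝ} (hw : ∀ y, 0 ≤ w y) (x : Eucl n) :
    0 ≤ mollify j w x :=
  integral_nonneg fun t => mul_nonneg ((bumpSeq n j).nonneg_normed t) (hw _)

theorem abs_mollify_le (j : ℕ) {u : Eucl n → ℝ} {M : ℝ}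
    (hu : ∀ᵐ x ∂(volume : Measure (Eucl n)), |u x| ≤ M) (x : Eucl n) : |mollify j u x| ≤ M := by
  refine (norm_mollify_le j u x).trans ?_
  have h1 : ∀ᵐ t ∂(volume : Measure (Eucl n)), |u (x - t)| ≤ M :=
    (quasiMeasurePreserving_sub_left volume x).ae hu
  calc ∫ t, (bumpSeq n j).normed volume t * ‖u (x - t)‖
      ≤ ∫ t, (bumpSeq n j).normed volume t * M := by
        refine integral_mono_of_nonneg (.of_forall fun t => ?_)
          ((bumpSeq n j).integrable_normed.mul_const _) ?_
        · exact mul_nonneg ((bumpSeq n j).nonneg_normed t) (norm_nonneg _)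
        · filter_upwards [h1] with t ht
          exact mul_le_mul_of_nonneg_left ht ((bumpSeq n j).nonneg_normed t)
    _ = M := by rw [integral_mul_const, (bumpSeq n j).integral_normed, one_mul]

theorem contDiff_mollify (j : ℕ) [CompleteSpace F] {w : Eucl n → F}
    (hw : LocallyIntegrable w volume) :
    ContDiff ℝ ((⊤ : ℕ∞) : WithTop ℕ∞) (mollify j w) :=
  ((bumpSeq n j).hasCompactSupport_normed (μ := volume)).contDiff_convolution_left _
    (bumpSeq n j).contDiff_normed hw

theorem ae_tendsto_mollify [CompleteSpace F] {w : Eucl n → F} (hw : LocallyIntegrable w volume) :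
    ∀ᵐ x ∂(volume : Measure (Eucl n)), Tendsto (fun j => mollify j w x) atTop (𝓝 (w x)) :=
  ContDiffBump.ae_convolution_tendsto_right_of_locallyIntegrable (K := 2) (tendsto_bumpSeq_rOut n)
    (.of_forall (bumpSeq_rOut_le n)) hw

theorem integrable_mollify (j : ℕ) {w : Eucl n → F} (hw : Integrable w) :
    Integrable (mollify j w) :=
  (bumpSeq n j).integrable_normed.integrable_convolution _ hw

theorem integral_mollify (j : ℕ) {w : Eucl n → ℝ} (hw : Integrable w) :
    ∫ x, mollify j w x = ∫ x, w x := by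
  refine (integral_convolution (ContinuousLinearMap.lsmul ℝ ℝ)
    ((bumpSeq n j).integrable_normed (μ := volume)) hw).trans ?_
  simp [(bumpSeq n j).integral_normed]

end mollify

/-! ### Mollification and variable exponents -/

theorem IsLogHolderOn.abs_sub_le {n : ℕ} {α : Eucl n → ℝ} {S : Set (Eucl n)} {L : ℝ} (hL : 0 < L)
    (h : ∀ x ∈ S, ∀ y ∈ S, |α x - α y| ≤ L / Real.log (Real.exp 1 + 1 / ‖x - y‖))
    {x y : Eucl n} (hx : x ∈ S) (hy : y ∈ S) {ε : ℝ} (hε : 0 < ε) (hxy : ‖x - y‖ ≤ ε) :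
    |α x - α y| ≤ L / Real.log (Real.exp 1 + 1 / ε) := by
  have he : 1 < Real.exp 1 + 1 / ε := by
    have := Real.add_one_le_exp (1 : ℝ)
    have : 0 < 1 / ε := by positivity
    linarith
  -- Since `1 / 0 = 0`, the modulus is not monotone at distance `0`, so `x = y` is treated apart.
  rcases (norm_nonneg (x - y)).eq_or_lt with h0 | h0
  · rw [sub_eq_zero.1 (norm_eq_zero.1 h0.symm), sub_self, abs_zero]
    exact div_nonneg hL.le (Real.log_pos he).le
  · refine (h x hx y hy).trans ?_
    have := Real.log_pos he
    gcongr

/-- Mollification acts on `L^{p(·)}` locally, in the sense of the modular, with a bound that is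
uniform in the scale. -/
theorem exists_norm_mollify_rpow_le {n : ℕ} {F : Type*} [NormedAddCommGroup F] [NormedSpace ℝ F]
    {p : Eucl n → ℝ} (hp : IsVariableExponent p) {v : Eucl n → F}
    (hv : LocallyIntegrable v volume) (r : ℝ)
    (hG : IntegrableOn (fun x => ‖v x‖ ^ p x) (closedBall 0 (r + 1))) :
    ∃ C : ℝ, 0 ≤ C ∧ ∀ j : ℕ, ∀ᵐ x ∂(volume : Measure (Eucl n)), x ∈ closedBall 0 r →
      ‖mollify j v x‖ ^ p x ≤
        C * (1 + mollify j ((closedBall 0 (r + 1)).indicator fun x => ‖v x‖ ^ p x) x) := by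
  obtain ⟨P, hP⟩ := hp.bddAbove
  obtain ⟨L, hL, hlog⟩ := hp.logHolder (r + 2)
  set G : Eucl n → ℝ := (closedBall 0 (r + 1)).indicator fun x => ‖v x‖ ^ p x with hGdef
  have hGint : Integrable G := hG.integrable_indicator measurableSet_closedBall
  have hG0 : ∀ x, 0 ≤ G x := Set.indicator_nonneg fun x _ => Real.rpow_nonneg (norm_nonneg _) _
  have hP1 : 1 ≤ P := by
    obtain ⟨x, hx⟩ := hP.exists
    exact (hp.one_le x).trans hx
  set ω := volume.real (closedBall (0 : Eucl n) 1) with hω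
  have hω0 : 0 < ω :=
    ENNReal.toReal_pos (measure_closedBall_pos _ _ one_pos).ne' measure_closedBall_lt_top.ne
  -- The kernel is at most `2 ^ n / (ω * ε ^ n)` because its outer radius is at most twice the inner
  -- one; hence `1 + mollify j G x ≤ D * (ε ^ n)⁻¹`.
  set D := 1 + 2 ^ n / ω * ∫ x, G x with hD
  have hGi0 : 0 ≤ ∫ x, G x := integral_nonneg hG0
  have hD1 : 1 ≤ D := le_add_of_nonneg_right (by positivity)
  set C := Real.exp (P * L * (Real.log D + n)) with hC
  refine ⟨(1 + C) ^ P, by positivity, fun j => ?_⟩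
  filter_upwards [hP] with x hPx hx
  set ε := (bumpSeq n j).rOut with hε
  have hε0 : 0 < ε := (bumpSeq n j).rOut_pos
  have hε1 : ε ≤ 1 := bumpSeq_rOut_le_one n j
  set φ := (bumpSeq n j).normed volume with hφ
  have hφ0 : ∀ t, 0 ≤ φ t := (bumpSeq n j).nonneg_normed
  have hsupp : ∀ t, φ t ≠ 0 → ‖t‖ < ε := fun t ht => by
    have : t ∈ Function.support φ := ht
    rwa [hφ, (bumpSeq n j).support_normed_eq, mem_ball_zero_iff] at this
  have hx' : ‖x‖ ≤ r := mem_closedBall_zero_iff.1 hx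
  have hxt : ∀ t, φ t ≠ 0 → ‖x - t‖ ≤ r + 1 := fun t ht => by
    linarith [norm_sub_le x t, hsupp t ht]
  have hGφ := integrable_normed_smul j hGint.locallyIntegrable x
  have hI : ∫ t, φ t * G (x - t) = mollify j G x := rfl
  have hIle : mollify j G x ≤ 2 ^ n / ω * (ε ^ n)⁻¹ * ∫ y, G y := by
    rw [← hI, ← integral_sub_left_eq_self G volume x, ← integral_const_mul]
    refine integral_mono hGφ ((hGint.comp_sub_left x).const_mul _) fun t => ?_
    refine mul_le_mul_of_nonneg_right ?_ (hG0 _)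
    refine ((bumpSeq n j).normed_le_div_measure_closedBall_rOut volume 2
      (bumpSeq_rOut_le n j) t).trans_eq ?_
    rw [Measure.addHaar_real_closedBall' volume _ hε0.le, finrank_euclideanSpace_fin, ← hω]
    field_simp
  have hI0 : 0 ≤ mollify j G x := mollify_nonneg j hG0 x
  have hID : 1 + mollify j G x ≤ D * (ε ^ n)⁻¹ := by
    have h1 : 1 ≤ (ε ^ n)⁻¹ := (one_le_inv₀ (by positivity)).2 (pow_le_one₀ hε0.le hε1)
    calc 1 + mollify j G x ≤ (ε ^ n)⁻¹ + 2 ^ n / ω * (ε ^ n)⁻¹ * ∫ y, G y := add_le_add h1 hIle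
      _ = D * (ε ^ n)⁻¹ := by rw [hD]; ring
  have key := convolution_rpow_le (δ := L / Real.log (Real.exp 1 + 1 / ε)) (C := C)
    (w := fun y => ‖v y‖) (G := G) (x := x) hp.one_le hP hφ0
    (bumpSeq n j).integrable_normed ((bumpSeq n j).integral_normed) hPx
    (div_nonneg hL.le (Real.log_nonneg ?_)) (fun y => norm_nonneg _) hG0
    (integrable_normed_smul j (fun y => (hv y).norm) x) hGφ ?_ ?_ ?_
  · refine le_trans ?_ key
    gcongr
    · exact zero_le_one.trans (hp.one_le x)
    · exact norm_mollify_le j v x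
  · have := Real.add_one_le_exp (1 : ℝ)
    have : 0 < 1 / ε := by positivity
    linarith
  · intro t ht
    refine IsLogHolderOn.abs_sub_le hL hlog ?_ ?_ hε0 ?_
    · rw [mem_ball_zero_iff]; linarith
    · rw [mem_ball_zero_iff]; linarith [hxt t ht]
    · simpa using (hsupp t ht).le
  · intro t ht
    rw [hGdef, Set.indicator_of_mem (mem_closedBall_zero_iff.2 (hxt t ht))]
  · exact rpow_div_log_le_exp (by rw [hI]; linarith) hD1 hL.le (by linarith) hε0
      (by rw [hI]; exact hID)

/-- Because the exponent is bounded, undoing the scaling by `μ` costs at most the constant factor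
`max 1 μ ^ P`. -/
theorem MemVarLp.integrableOn_rpow {n : ℕ} {F : Type*} [NormedAddCommGroup F] [NormedSpace ℝ F]
    {p : Eucl n → ℝ} (hp : IsVariableExponent p) {K : Set (Eucl n)} {w : Eucl n → F}
    (hw : MemVarLp p K w) : IntegrableOn (fun x => ‖w x‖ ^ p x) K := by
  obtain ⟨hm, μ, hμ, hfin⟩ := hw
  obtain ⟨P, hP⟩ := hp.bddAbove
  have hpm : AEMeasurable p (volume.restrict K) := hp.measurable.restrict
  have h0 : IntegrableOn (fun x => ‖μ⁻¹ • w x‖ ^ p x) K := by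
    refine (lintegral_ofReal_ne_top_iff_integrable ?_ ?_).1 hfin.ne
    · exact ((hm.const_smul μ⁻¹).norm.aemeasurable.pow hpm).aestronglyMeasurable
    · exact .of_forall fun x => Real.rpow_nonneg (norm_nonneg _) _
  refine (Integrable.const_mul h0 (max 1 μ ^ P)).mono'
    (hm.norm.aemeasurable.pow hpm).aestronglyMeasurable ?_
  filter_upwards [ae_restrict_of_ae hP] with x hx
  have hp0 : 0 ≤ p x := zero_le_one.trans (hp.one_le x)
  rw [Real.norm_of_nonneg (Real.rpow_nonneg (norm_nonneg _) _)]
  calc ‖w x‖ ^ p x = (μ * ‖μ⁻¹ • w x‖) ^ p x := by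
        rw [norm_smul, Real.norm_of_nonneg (inv_nonneg.2 hμ.le), mul_inv_cancel_left₀ hμ.ne']
    _ = μ ^ p x * ‖μ⁻¹ • w x‖ ^ p x := Real.mul_rpow hμ.le (norm_nonneg _)
    _ ≤ max 1 μ ^ P * ‖μ⁻¹ • w x‖ ^ p x := by
      gcongr
      calc μ ^ p x ≤ max 1 μ ^ p x := by
            gcongr
            exact le_max_right _ _
        _ ≤ max 1 μ ^ P := Real.rpow_le_rpow_of_exponent_le (le_max_left _ _) hx

/-! ### Weak gradients and test functions -/

theorem hasGradientAt_mollify {n : ℕ} {u : Eucl n → ℝ} {v : Eucl n → Eucl n}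
    (h : HasWeakGradient u v) (j : ℕ) (x : Eucl n) :
    HasGradientAt (mollify j u) (mollify j v x) x := by
  obtain ⟨hu, -, hw⟩ := h
  set φ := (bumpSeq n j).normed (volume : Measure (Eucl n)) with hφ
  have hφc : HasCompactSupport φ := (bumpSeq n j).hasCompactSupport_normed
  have hφs : ContDiff ℝ ((⊤ : ℕ∞) : WithTop ℕ∞) φ := (bumpSeq n j).contDiff_normed
  have hφ1 : ContDiff ℝ 1 φ := hφs.of_le (by exact_mod_cast le_top)
  have hψ : IsTestFunction fun y => φ (x - y) :=
    ⟨hφs.comp (contDiff_const.sub contDiff_id), hφc.comp_homeomorph (Homeomorph.subLeft x)⟩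
  have hgrad : ∀ y, gradient (fun y => φ (x - y)) y = -gradient φ (x - y) := fun y => by
    refine HasGradientAt.gradient (hasGradientAt_iff_hasFDerivAt.2 ?_)
    rw [map_neg, toDual_gradient]
    have h1 : HasFDerivAt φ (fderiv ℝ φ (x - y)) (x - y) :=
      (hφ1.differentiable (by simp) _).hasFDerivAt
    have h2 := h1.comp y ((hasFDerivAt_id y).const_sub x)
    refine HasFDerivAt.congr_fderiv (f := fun y => φ (x - y)) h2 ?_
    ext e
    simp
  -- The weak gradient is tested with `y ↦ φ (x - y)`; the sign from integration by parts cancels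
  -- the one from the reflection.
  have hv : mollify j v x = ∫ t, u (x - t) • gradient φ t := by
    calc mollify j v x = ∫ y, φ (x - y) • v y := by
          rw [mollify_apply, ← integral_sub_left_eq_self _ volume x]
          simp [hφ]
      _ = ∫ y, u y • gradient φ (x - y) := by
          rw [← neg_neg (∫ y, φ (x - y) • v y), ← hw _ hψ, ← integral_neg]
          simp [hgrad]
      _ = ∫ t, u (x - t) • gradient φ t := by
          rw [← integral_sub_left_eq_self _ volume x]
          simp
  have key := hφc.hasFDerivAt_convolution_left (ContinuousLinearMap.lsmul ℝ ℝ) hφ1 hu x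
  rw [hasGradientAt_iff_hasFDerivAt, hv]
  refine key.congr_fderiv (Eq.symm ?_)
  rw [← LinearIsometryEquiv.coe_toContinuousLinearEquiv,
    ← ContinuousLinearEquiv.integral_comp_comm]
  refine integral_congr_ae (.of_forall fun t => ?_)
  ext e
  simp [mul_comm]

theorem integrable_inner_of_hasCompactSupport {n : ℕ} {a w : Eucl n → Eucl n}
    (ha : LocallyIntegrable a volume) (hw : Continuous w) (hc : HasCompactSupport w) :
    Integrable fun x => inner ℝ (a x) (w x) := by
  have h := LocallyIntegrable.integrable_smul_left_of_hasCompactSupport (μ := volume)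
    (f := fun x => ‖a x‖) (fun y => (ha y).norm) hw.norm hc.norm
  refine h.mono' (ha.aestronglyMeasurable.inner hw.aestronglyMeasurable) (.of_forall fun x => ?_)
  rw [smul_eq_mul, mul_comm]
  exact norm_inner_le_norm _ _

theorem IsTestFunction.continuous_gradient {n : ℕ} {ψ : Eucl n → ℝ} (h : IsTestFunction ψ) :
    Continuous (gradient ψ) :=
  (InnerProductSpace.toDual ℝ (Eucl n)).symm.continuous.comp
    (h.1.continuous_fderiv (by simp))

theorem IsTestFunction.hasCompactSupport_gradient {n : ℕ} {ψ : Eucl n → ℝ}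
    (h : IsTestFunction ψ) : HasCompactSupport (gradient ψ) :=
  (h.2.fderiv ℝ).comp_left (map_zero (InnerProductSpace.toDual ℝ (Eucl n)).symm)

theorem locallyIntegrable_of_norm_le_rpow {n : ℕ} {p : Eucl n → ℝ} (hp : IsVariableExponent p)
    {v a : Eucl n → Eucl n} (hv : ∀ r, IntegrableOn (fun x => ‖v x‖ ^ p x) (closedBall 0 r))
    (ha : AEStronglyMeasurable a volume) {B : ℝ} (hB0 : 0 ≤ B)
    (hB : ∀ x, ‖a x‖ ≤ B * ‖v x‖ ^ (p x - 1)) : LocallyIntegrable a volume := by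
  refine (locallyIntegrable_iff).2 fun K hK => ?_
  obtain ⟨r, hr⟩ := hK.isBounded.subset_closedBall 0
  refine IntegrableOn.mono_set ?_ hr
  have h1 : IntegrableOn (fun x => B * (‖v x‖ ^ p x + 1)) (closedBall 0 r) :=
    ((hv r).add (integrableOn_const measure_closedBall_lt_top.ne)).const_mul B
  refine Integrable.mono' h1 ha.restrict (.of_forall fun x => (hB x).trans ?_)
  gcongr
  simpa using rpow_sub_one_mul_le_add (norm_nonneg (v x)) zero_le_one (hp.one_le x)

/-- Testing with `ψ (u + M + 1)`: the product of a nonnegative test function and a bounded Sobolev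
function is an admissible test function. -/
theorem integral_add_integral_inner_le {n : ℕ} {p : Eucl n → ℝ} (hp : IsVariableExponent p)
    {u : Eucl n → ℝ} {v a : Eucl n → Eucl n} (hu : MemVarSobolevLoc p u v) {M : ℝ}
    (hM : ∀ᵐ x ∂(volume : Measure (Eucl n)), |u x| ≤ M)
    (ha : AEStronglyMeasurable a volume) {B : ℝ} (hB0 : 0 ≤ B)
    (hB : ∀ x, ‖a x‖ ≤ B * ‖v x‖ ^ (p x - 1)) {c : ℝ} (hc : 0 ≤ c)
    (hineq : ∀ φ : Eucl n → ℝ, IsTestFunction φ → (∀ x, 0 ≤ φ x) →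
      c * ∫ x, φ x ≤ -∫ x, inner ℝ (a x) (gradient φ x))
    {ψ : Eucl n → ℝ} (hψ : IsTestFunction ψ) (hψ0 : ∀ x, 0 ≤ ψ x) :
    c * (∫ x, ψ x) + ∫ x, ψ x * inner ℝ (a x) (v x)
      ≤ -∫ x, (u x + M + 1) * inner ℝ (a x) (gradient ψ x) := by
  have hvp : ∀ r, IntegrableOn (fun x => ‖v x‖ ^ p x) (closedBall 0 r) := fun r =>
    (hu.memLp_gradient _ (isCompact_closedBall 0 r)).integrableOn_rpow hp
  have hal : LocallyIntegrable a volume := locallyIntegrable_of_norm_le_rpow hp hvp ha hB0 hB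
  obtain ⟨hul, hvl, -⟩ := hu.weakGradient
  have hM0 : 0 ≤ M := by
    obtain ⟨x, hx⟩ := hM.exists
    exact (abs_nonneg _).trans hx
  obtain ⟨r, hr⟩ := hψ.2.isCompact.isBounded.subset_closedBall 0
  obtain ⟨S, hS⟩ := hψ.1.continuous.bounded_above_of_compact_support hψ.2
  have hS0 : 0 ≤ S := (norm_nonneg _).trans (hS 0)
  obtain ⟨C, hC0, hC⟩ := exists_norm_mollify_rpow_le hp hvl r (hvp (r + 1))
  set G : Eucl n → ℝ := (closedBall 0 (r + 1)).indicator fun x => ‖v x‖ ^ p x with hGdef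
  have hGint : Integrable G := (hvp (r + 1)).integrable_indicator measurableSet_closedBall
  have hG0 : ∀ x, 0 ≤ G x := Set.indicator_nonneg fun x _ => Real.rpow_nonneg (norm_nonneg _) _
  set χ : Eucl n → ℝ := (closedBall 0 r).indicator fun _ => 1 with hχdef
  have hχint : Integrable χ :=
    (integrableOn_const measure_closedBall_lt_top.ne).integrable_indicator measurableSet_closedBall
  have hχ0 : ∀ x, 0 ≤ χ x := Set.indicator_nonneg fun x _ => zero_le_one
  have hψg := hψ.continuous_gradient
  have hψgc := hψ.hasCompactSupport_gradient
  have hus : ∀ j, ContDiff ℝ ((⊤ : ℕ∞) : WithTop ℕ∞) (mollify j u) := fun j => contDiff_mollify j hul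
  have hvs : ∀ j, Continuous (mollify j v) := fun j => (contDiff_mollify j hvl).continuous
  have hub : ∀ j x, |mollify j u x| ≤ M := fun j x => abs_mollify_le j hM x
  have hF1 : ∀ j, Integrable fun x => ψ x * inner ℝ (a x) (mollify j v x) := fun j => by
    refine (integrable_inner_of_hasCompactSupport hal (hψ.1.continuous.smul (hvs j))
      hψ.2.smul_right).congr (.of_forall fun x => ?_)
    simp [inner_smul_right]
  have hF2 : ∀ j, Integrable fun x =>
      (mollify j u x + M + 1) * inner ℝ (a x) (gradient ψ x) := fun j => by
    refine (integrable_inner_of_hasCompactSupport hal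
      ((((hus j).continuous.add_const M).add_const 1).smul hψg)
      hψgc.smul_left).congr (.of_forall fun x => ?_)
    simp [inner_smul_right]
  have hstep : ∀ j, c * (∫ x, ψ x) + ∫ x, ψ x * inner ℝ (a x) (mollify j v x)
      ≤ -∫ x, (mollify j u x + M + 1) * inner ℝ (a x) (gradient ψ x) := fun j => by
    have hφs : ContDiff ℝ ((⊤ : ℕ∞) : WithTop ℕ∞) fun x => ψ x * (mollify j u x + M + 1) :=
      hψ.1.mul (((hus j).add contDiff_const).add contDiff_const)
    have hφc : HasCompactSupport fun x => ψ x * (mollify j u x + M + 1) := hψ.2.mul_right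
    -- The summand `1` in `u + M + 1` serves here: the factor is at least `1`, so the term with `c`
    -- survives.
    have hfac : ∀ x, 1 ≤ mollify j u x + M + 1 := fun x => by linarith [(abs_le.1 (hub j x)).1]
    have hgrad : ∀ x, gradient (fun x => ψ x * (mollify j u x + M + 1)) x =
        ψ x • mollify j v x + (mollify j u x + M + 1) • gradient ψ x := fun x => by
      refine HasGradientAt.gradient (hasGradientAt_iff_hasFDerivAt.2 ?_)
      have h1 : HasFDerivAt ψ (fderiv ℝ ψ x) x := (hψ.1.differentiable (by simp) x).hasFDerivAt
      have h2 := (((hasGradientAt_mollify hu.weakGradient j x).hasFDerivAt).add_const M).add_const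
        (1 : ℝ)
      rw [map_add, map_smul, map_smul, toDual_gradient]
      exact h1.mul h2
    have h := hineq _ ⟨hφs, hφc⟩ fun x => mul_nonneg (hψ0 x) (zero_le_one.trans (hfac x))
    simp only [hgrad, inner_add_right, inner_smul_right] at h
    rw [integral_add (hF1 j) (hF2 j)] at h
    have h3 : ∫ x, ψ x ≤ ∫ x, ψ x * (mollify j u x + M + 1) :=
      integral_mono (hψ.1.continuous.integrable_of_hasCompactSupport hψ.2)
        (hφs.continuous.integrable_of_hasCompactSupport hφc)
        fun x => le_mul_of_one_le_right (hψ0 x) (hfac x)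
    have := mul_le_mul_of_nonneg_left h3 hc
    linarith
  have hlim2 : Tendsto (fun j => ∫ x, (mollify j u x + M + 1) * inner ℝ (a x) (gradient ψ x)) atTop
      (𝓝 (∫ x, (u x + M + 1) * inner ℝ (a x) (gradient ψ x))) := by
    refine tendsto_integral_of_dominated_convergence
      (fun x => (2 * M + 1) * |inner ℝ (a x) (gradient ψ x)|) (fun j => (hF2 j).1)
      ((integrable_inner_of_hasCompactSupport hal hψg hψgc).abs.const_mul _)
      (fun j => .of_forall fun x => ?_) ?_
    · rw [norm_mul, Real.norm_eq_abs, Real.norm_eq_abs]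
      gcongr
      have := abs_le.1 (hub j x)
      exact abs_le.2 ⟨by linarith, by linarith⟩
    · filter_upwards [ae_tendsto_mollify hul] with x hx
      exact ((hx.add_const M).add_const 1).mul_const _
  have hlim1 : Tendsto (fun j => ∫ x, ψ x * inner ℝ (a x) (mollify j v x)) atTop
      (𝓝 (∫ x, ψ x * inner ℝ (a x) (v x))) := by
    refine tendsto_integral_of_dominated_of_tendsto
      (g := fun j x => S * B * (G x + C * (χ x + mollify j G x)))
      (g₀ := fun x => S * B * (G x + C * (χ x + G x))) hF1
      (fun j => (hGint.add ((hχint.add (integrable_mollify j hGint)).const_mul C)).const_mul _)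
      ((hGint.add ((hχint.add hGint).const_mul C)).const_mul _) (fun j => ?_) ?_ ?_ ?_
    · filter_upwards [hC j] with x hx
      have hmG : 0 ≤ mollify j G x := mollify_nonneg j hG0 x
      by_cases hxr : x ∈ closedBall 0 r
      · have hxr' : x ∈ closedBall (0 : Eucl n) (r + 1) :=
          closedBall_subset_closedBall (by linarith) hxr
        have hGx : G x = ‖v x‖ ^ p x := Set.indicator_of_mem hxr' _
        have hχx : χ x = 1 := Set.indicator_of_mem hxr _
        rw [abs_mul, hGx, hχx, mul_assoc]
        gcongr
        · exact hS x
        calc |inner ℝ (a x) (mollify j v x)| ≤ ‖a x‖ * ‖mollify j v x‖ := abs_real_inner_le_norm _ _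
          _ ≤ B * ‖v x‖ ^ (p x - 1) * ‖mollify j v x‖ := by
            gcongr
            exact hB x
          _ = B * (‖v x‖ ^ (p x - 1) * ‖mollify j v x‖) := by ring
          _ ≤ B * (‖v x‖ ^ p x + ‖mollify j v x‖ ^ p x) := by
            gcongr
            exact rpow_sub_one_mul_le_add (norm_nonneg _) (norm_nonneg _) (hp.one_le x)
          _ ≤ _ := by
            gcongr
            exact hx hxr
      · have : ψ x = 0 := image_eq_zero_of_notMem_tsupport fun h => hxr (hr h)
        rw [this, zero_mul, abs_zero]
        have := hG0 x
        have := hχ0 x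
        positivity
    · filter_upwards [ae_tendsto_mollify hvl] with x hx
      exact (tendsto_const_nhds.inner hx).const_mul _
    · filter_upwards [ae_tendsto_mollify hGint.locallyIntegrable] with x hx
      exact (((hx.const_add _).const_mul _).const_add _).const_mul _
    -- The integrals of the majorants do not depend on `j`, since mollification preserves the
    -- integral of `G`.
    · refine tendsto_const_nhds.congr fun j => ?_
      have hmG := integrable_mollify j hGint
      have hsum : ∀ g : Eucl n → ℝ, Integrable g →
          ∫ x, (G x + C * (χ x + g x)) = (∫ x, G x) + C * ((∫ x, χ x) + ∫ x, g x) := fun g hg => by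
        rw [← integral_add hχint hg, ← integral_const_mul]
        exact integral_add hGint ((hχint.add hg).const_mul C)
      rw [integral_const_mul, integral_const_mul, hsum _ hGint, hsum _ hmG, integral_mollify j hGint]
  exact le_of_tendsto_of_tendsto' (hlim1.const_add _) hlim2.neg hstep

/-! ### Caccioppoli-type estimate -/

theorem gradient_pow_succ {n : ℕ} {η : Eucl n → ℝ} (hη : Differentiable ℝ η) (k : ℕ) (x : Eucl n) :
    gradient (fun x => η x ^ (k + 1)) x = ((k + 1) * η x ^ k) • gradient η x := by
  refine HasGradientAt.gradient (hasGradientAt_iff_hasFDerivAt.2 ?_)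
  rw [map_smul, toDual_gradient]
  have := (hη x).hasFDerivAt.pow (k + 1)
  refine HasFDerivAt.congr_fderiv (f := fun x => η x ^ (k + 1)) this ?_
  ext e
  simp

/-- The Caccioppoli-type estimate for a field `a` of `p(·)`-growth with `div a ≥ c`, tested with
powers of a cut-off function whose gradient is small. -/
theorem integral_cutoff_pow_le {n : ℕ} {p : Eucl n → ℝ} (hp : IsVariableExponent p)
    {u : Eucl n → ℝ} {v a : Eucl n → Eucl n} (hu : MemVarSobolevLoc p u v) {M : ℝ}
    (hM : ∀ᵐ x ∂(volume : Measure (Eucl n)), |u x| ≤ M)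
    (ha : AEStronglyMeasurable a volume) {α B : ℝ} (hα : 0 < α) (hB0 : 0 ≤ B)
    (hB : ∀ x, ‖a x‖ ≤ B * ‖v x‖ ^ (p x - 1)) (hcoer : ∀ x, α * ‖v x‖ ^ p x ≤ inner ℝ (a x) (v x))
    {c : ℝ} (hc : 0 ≤ c)
    (hineq : ∀ φ : Eucl n → ℝ, IsTestFunction φ → (∀ x, 0 ≤ φ x) →
      c * ∫ x, φ x ≤ -∫ x, inner ℝ (a x) (gradient φ x))
    {k : ℕ} (hk1 : 1 ≤ k) (hk : ∀ᵐ x ∂(volume : Measure (Eucl n)), p x ≤ k + 1)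
    {η : Eucl n → ℝ} (hη : IsTestFunction η) (hη0 : ∀ x, 0 ≤ η x) (hη1 : ∀ x, η x ≤ 1)
    (hsmall : ∀ x, (2 * M + 1) * (k + 1) * B * ‖gradient η x‖ ≤ α) :
    c * ∫ x, η x ^ (k + 1) ≤ (2 * M + 1) * (k + 1) * B * ∫ x, ‖gradient η x‖ := by
  have hvp : ∀ r, IntegrableOn (fun x => ‖v x‖ ^ p x) (closedBall 0 r) := fun r =>
    (hu.memLp_gradient _ (isCompact_closedBall 0 r)).integrableOn_rpow hp
  have hal : LocallyIntegrable a volume := locallyIntegrable_of_norm_le_rpow hp hvp ha hB0 hB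
  have hvl : LocallyIntegrable (fun x => ‖v x‖ ^ p x) volume :=
    locallyIntegrable_iff.2 fun K hK =>
      have ⟨r, hr⟩ := hK.isBounded.subset_closedBall 0
      (hvp r).mono_set hr
  have hM0 : 0 ≤ M := by
    obtain ⟨x, hx⟩ := hM.exists
    exact (abs_nonneg _).trans hx
  have hψ : IsTestFunction fun x => η x ^ (k + 1) :=
    ⟨hη.1.pow _, hη.2.comp_left (g := fun t : ℝ => t ^ (k + 1)) (zero_pow k.succ_ne_zero)⟩
  have hψ0 : ∀ x, 0 ≤ η x ^ (k + 1) := fun x => pow_nonneg (hη0 x) _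
  have main := integral_add_integral_inner_le hp hu hM ha hB0 hB hc hineq hψ hψ0
  have hum : AEStronglyMeasurable u volume := hu.weakGradient.1.aestronglyMeasurable
  have hvm : AEStronglyMeasurable v volume := hu.weakGradient.2.1.aestronglyMeasurable
  have hI1 : Integrable fun x => η x ^ (k + 1) * inner ℝ (a x) (v x) := by
    have h := (hvl.integrable_smul_left_of_hasCompactSupport hψ.1.continuous hψ.2).const_mul
      (B * 2)
    refine h.mono' (hψ.1.continuous.aestronglyMeasurable.mul (ha.inner hvm))
      (.of_forall fun x => ?_)
    rw [norm_mul, Real.norm_of_nonneg (hψ0 x), smul_eq_mul, mul_left_comm]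
    gcongr
    · exact hψ0 x
    calc ‖inner ℝ (a x) (v x)‖ ≤ ‖a x‖ * ‖v x‖ := norm_inner_le_norm _ _
      _ ≤ B * ‖v x‖ ^ (p x - 1) * ‖v x‖ := by
        gcongr
        exact hB x
      _ = B * (‖v x‖ ^ (p x - 1) * ‖v x‖) := mul_assoc _ _ _
      _ ≤ B * (‖v x‖ ^ p x + ‖v x‖ ^ p x) := by
        gcongr
        exact rpow_sub_one_mul_le_add (norm_nonneg _) (norm_nonneg _) (hp.one_le x)
      _ = B * 2 * ‖v x‖ ^ p x := by ring
  have hg := integrable_inner_of_hasCompactSupport hal hψ.continuous_gradient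
    hψ.hasCompactSupport_gradient
  have hub : ∀ᵐ x ∂(volume : Measure (Eucl n)), |u x + M + 1| ≤ 2 * M + 1 := by
    filter_upwards [hM] with x hx
    have := abs_le.1 hx
    exact abs_le.2 ⟨by linarith, by linarith⟩
  have hI2 : Integrable fun x =>
      (u x + M + 1) * inner ℝ (a x) (gradient (fun x => η x ^ (k + 1)) x) := by
    refine hg.bdd_mul (c := 2 * M + 1)
      ((hum.add aestronglyMeasurable_const).add aestronglyMeasurable_const) ?_
    filter_upwards [hub] with x hx using hx
  have hIg : Integrable fun x => ‖gradient η x‖ :=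
    hη.continuous_gradient.norm.integrable_of_hasCompactSupport hη.hasCompactSupport_gradient.norm
  -- The energy is subtracted inside the integral, so that Young's inequality cancels it pointwise.
  have hpt : ∫ x, (-((u x + M + 1) * inner ℝ (a x) (gradient (fun x => η x ^ (k + 1)) x)) -
      η x ^ (k + 1) * inner ℝ (a x) (v x)) ≤
      ∫ x, (2 * M + 1) * (k + 1) * B * ‖gradient η x‖ := by
    refine integral_mono_ae (hI2.neg.sub hI1) (hIg.const_mul _) ?_
    filter_upwards [hub, hk] with x hx hkx
    have h1 : -((u x + M + 1) * inner ℝ (a x) (gradient (fun x => η x ^ (k + 1)) x)) ≤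
        (2 * M + 1) * (k + 1) * B * ‖v x‖ ^ (p x - 1) * (η x ^ k * ‖gradient η x‖) := by
      refine (neg_le_abs _).trans ?_
      rw [abs_mul, gradient_pow_succ (hη.1.differentiable (by simp)), inner_smul_right, abs_mul,
        abs_of_nonneg (by have := hη0 x; positivity : 0 ≤ (k + 1 : ℝ) * η x ^ k)]
      calc |u x + M + 1| * ((k + 1) * η x ^ k * |inner ℝ (a x) (gradient η x)|)
          ≤ (2 * M + 1) * ((k + 1) * η x ^ k * (B * ‖v x‖ ^ (p x - 1) * ‖gradient η x‖)) := by
            have := hη0 x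
            gcongr
            exact (abs_real_inner_le_norm _ _).trans
              (mul_le_mul_of_nonneg_right (hB x) (norm_nonneg _))
        _ = _ := by ring
    have h2 := mul_rpow_sub_one_mul_pow_le (norm_nonneg (v x)) (norm_nonneg (gradient η x)) (hη0 x)
      (hη1 x) hα (by positivity : 0 ≤ (2 * M + 1) * (k + 1) * B) (hp.one_le x) hkx hk1 (hsmall x)
    have h3 := mul_le_mul_of_nonneg_left (hcoer x) (hψ0 x)
    linarith
  have hsub := integral_sub hI2.neg hI1
  simp only [Pi.neg_apply, integral_neg] at hsub
  rw [hsub, integral_const_mul] at hpt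
  linarith

/-! ### Scaling and conclusion -/

theorem IsTestFunction.comp_inv_smul {n : ℕ} {η : Eucl n → ℝ} (hη : IsTestFunction η) {R : ℝ}
    (hR : R ≠ 0) : IsTestFunction fun x => η (R⁻¹ • x) :=
  ⟨hη.1.comp (contDiff_const_smul _), hη.2.comp_smul (inv_ne_zero hR)⟩

theorem gradient_comp_smul {n : ℕ} {η : Eucl n → ℝ} (hη : Differentiable ℝ η) (r : ℝ)
    (x : Eucl n) : gradient (fun x => η (r • x)) x = r • gradient η (r • x) := by
  refine HasGradientAt.gradient (hasGradientAt_iff_hasFDerivAt.2 ?_)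
  rw [map_smul, toDual_gradient]
  have := (hη (r • x)).hasFDerivAt.comp x ((hasFDerivAt_id x).const_smul r)
  refine HasFDerivAt.congr_fderiv (f := fun x => η (r • x)) this ?_
  ext e
  simp

theorem corollary4p6 (n : ℕ) (hn : 1 ≤ n)
    (p : Eucl n → ℝ) (hp : IsVariableExponent p) (hpn : (n : ℝ) < essInf p volume)
    (A : Eucl n → ℝ → Eucl n → Eucl n) (hA : HasVarGrowth p A)
    (f : ℝ → ℝ) (hf_cont : Continuous f) (hf_nonneg : ∀ t, 0 ≤ f t)
    (hf_mono : StrictMono f) (hf_zero : f 0 ≠ 0) :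
    ¬ ∃ u : Eucl n → ℝ, IsSupersolution p A f u ∧
      ∃ M : ℝ, ∀ᵐ x ∂(volume : Measure (Eucl n)), |u x| ≤ M := by
  rintro ⟨u, ⟨v, hu, hsup⟩, M, hM⟩
  obtain ⟨a, b, α, B, -, -, hα, haα, hab, hbB, hcoer, hgrowth⟩ := hA.bounds
  have hM0 : 0 ≤ M := by
    obtain ⟨x, hx⟩ := hM.exists
    exact (abs_nonneg _).trans hx
  have hB0 : 0 ≤ B := hα.le.trans ((haα 0).trans ((hab 0).trans (hbB 0)))
  have hc : 0 < f (-M) := (hf_nonneg (-M - 1)).trans_lt (hf_mono (by linarith))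
  have hAm : AEStronglyMeasurable (fun x => A x (u x) (v x)) volume :=
    (hA.caratheodory.aemeasurable_comp hu.weakGradient.1.aestronglyMeasurable.aemeasurable
      hu.weakGradient.2.1.aestronglyMeasurable.aemeasurable).aestronglyMeasurable
  have hineq : ∀ φ : Eucl n → ℝ, IsTestFunction φ → (∀ x, 0 ≤ φ x) →
      f (-M) * ∫ x, φ x ≤ -∫ x, inner ℝ (A x (u x) (v x)) (gradient φ x) := fun φ hφ hφ0 => by
    obtain ⟨hi, hle⟩ := hsup φ hφ hφ0
    refine le_trans ?_ hle
    rw [← integral_const_mul]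
    refine integral_mono_ae
      ((hφ.1.continuous.integrable_of_hasCompactSupport hφ.2).const_mul _) hi ?_
    filter_upwards [hM] with x hx
    exact mul_le_mul_of_nonneg_right (hf_mono.monotone (abs_le.1 hx).1) (hφ0 x)
  obtain ⟨P, hP⟩ := hp.bddAbove
  -- The ceiling gives `p ≤ k + 1` a.e.; the extra `1` gives `k ≥ 1`, so `η ^ k` vanishes where `η`
  -- does.
  set k : ℕ := ⌈P⌉₊ + 1 with hkdef
  have hk : ∀ᵐ x ∂(volume : Measure (Eucl n)), p x ≤ k + 1 := by
    filter_upwards [hP] with x hx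
    have := Nat.le_ceil P
    rw [hkdef]
    push_cast
    linarith
  let η : ContDiffBump (0 : Eucl n) := ⟨1, 2, one_pos, one_lt_two⟩
  have hη : IsTestFunction η := ⟨η.contDiff, η.hasCompactSupport⟩
  have hηd : Differentiable ℝ η := hη.1.differentiable (by simp)
  obtain ⟨C, hC⟩ :=
    hη.continuous_gradient.bounded_above_of_compact_support hη.hasCompactSupport_gradient
  set N := (2 * M + 1) * (k + 1) * B with hN
  have hN0 : 0 ≤ N := by positivity
  have hpos : 0 < ∫ x, η x ^ (k + 1) := by
    refine Continuous.integral_pos_of_hasCompactSupport_nonneg_nonzero (x := 0)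
      (η.continuous.pow _)
      (hη.2.comp_left (g := fun t : ℝ => t ^ (k + 1)) (zero_pow k.succ_ne_zero))
      (fun x => pow_nonneg η.nonneg _) ?_
    have : η 0 = 1 := η.one_of_mem_closedBall (mem_closedBall_self zero_le_one)
    simp [this]
  have hscale : ∀ᶠ R : ℝ in atTop,
      f (-M) * ∫ x, η x ^ (k + 1) ≤ R⁻¹ * (N * ∫ x, ‖gradient η x‖) := by
    have hsm : ∀ᶠ R : ℝ in atTop, R⁻¹ * (N * C) < α := by
      have : Tendsto (fun R : ℝ => R⁻¹ * (N * C)) atTop (𝓝 0) := by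
        simpa using tendsto_inv_atTop_zero.mul_const (N * C)
      exact this.eventually_lt_const hα
    filter_upwards [hsm, eventually_gt_atTop 0] with R hR hR0
    have hηR : IsTestFunction fun x => η (R⁻¹ • x) := hη.comp_inv_smul hR0.ne'
    have hgR : ∀ x, ‖gradient (fun x => η (R⁻¹ • x)) x‖ = R⁻¹ * ‖gradient η (R⁻¹ • x)‖ :=
      fun x => by
        rw [gradient_comp_smul hηd, norm_smul, Real.norm_of_nonneg (by positivity)]
    have key := integral_cutoff_pow_le hp hu hM hAm hα hB0
      (fun x => (hgrowth x (u x) (v x)).trans (by gcongr; exact hbB x))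
      (fun x => le_trans (by gcongr; exact haα x) (hcoer x (u x) (v x))) hc.le hineq
      (Nat.le_add_left 1 _) hk hηR (fun x => η.nonneg) (fun x => η.le_one) (fun x => by
        rw [hgR, ← hN]
        calc N * (R⁻¹ * ‖gradient η (R⁻¹ • x)‖) = R⁻¹ * (N * ‖gradient η (R⁻¹ • x)‖) := by ring
          _ ≤ R⁻¹ * (N * C) := by
            gcongr
            exact hC _
          _ ≤ α := hR.le)
    simp only [hgR] at key
    rw [integral_const_mul, Measure.integral_comp_inv_smul volume (fun x => ‖gradient η x‖) R,
      Measure.integral_comp_inv_smul volume (fun x => η x ^ (k + 1)) R, ← hN, smul_eq_mul,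
      smul_eq_mul] at key
    -- Both integrals carry the same Jacobian `R ^ n`; after dividing it out, the factor `R⁻¹` from
    -- the gradient remains on the right.
    have hRn : 0 < |R ^ Module.finrank ℝ (Eucl n)| := by positivity
    refine le_of_mul_le_mul_left ?_ hRn
    linarith
  have hlim : Tendsto (fun R : ℝ => R⁻¹ * (N * ∫ x, ‖gradient η x‖)) atTop (𝓝 0) := by
    simpa using tendsto_inv_atTop_zero.mul_const (N * ∫ x, ‖gradient η x‖)
  exact (mul_pos hc hpos).not_ge (ge_of_tendsto hlim hscale)
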